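/- Let $\mathbb N=\{0,1,2,\dots\}$, let $\mathbb D$ be the open unit disc of $\mathbb C$, $\mathbb T$ the unit circle, $H(\mathbb D)$ the set of holomorphic functions on $\mathbb D$, and for $r\in[0,1)$ let $\phi_r(z)=rz$. Let $(K_l)_{l\in\mathbb N}$ be a sequence of compact subsets of $\mathbb T$ such that each $\mathbb C\setminus K_l$ is connected and every compact set $L\subset\mathbb T$ with $L\neq\mathbb T$ is contained in some $K_l$. For each $l\in\mathbb N$ let $(V_n(l))_{n\in\mathbb N}$ be a sequence of non-empty open balls of $C(K_l)$ (the continuous complex functions on $K_l$ with the uniform norm) which form a base of its topology. Let $\{\Gamma(l,n,m): l,n,m\in\mathbb N\}$ be a family of segments in $[0,1)$, that is, of compact intervals contained in $[0,1)$, possibly reduced to a point or empty. Assume that $\Gamma(l,n,m)\cap\Gamma(l',n',m')=\emptyset$ whenever $(l,n,m)\ne(l',n',m')$, and that the family is locally finite, i.e. every compact subset of $[0,1)$ meets $\Gamma(l,n,m)$ for at most finitely many $(l,n,m)$. Set $\Gamma(l,n)=\bigcup_{m\in\mathbb N}\Gamma(l,n,m)$. Let $\varepsilon>0$, $g\in H(\mathbb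 D)$, and let $D=\{z\in\mathbb C:|z|\le\rho\}$ with $\rho<1$. Then there exist a family $\{r(l,n): l,n\in\mathbb N\}$ in $[0,1)$ and a function $f\in H(\mathbb D)$ such that $\sup_{D}|f-g|<\varepsilon$ and such that for all $l,n\in\mathbb N$ and all $r\in\Gamma(l,n)\cap[r(l,n),1)$, the restriction of $f\circ\phi_r$ to $K_l$ belongs to $V_n(l)$. -/

import Mathlib

open Set TopologicalSpace

/-- The open unit disc of `ℂ`. -/
abbrev unitDisc : Set ℂ := Metric.ball (0 : ℂ) 1

/-- The unit circle of `ℂ`. -/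
abbrev unitCircle : Set ℂ := Metric.sphere (0 : ℂ) 1

/-- `f ∈ H(𝔻)`: only the values of `f` on the open unit disc are relevant. -/
def HolomorphicOnDisc (f : ℂ → ℂ) : Prop := DifferentiableOn ℂ f unitDisc

/-- The dilation `φ_r : z ↦ r z`. -/
def dilation (r : ℝ) (z : ℂ) : ℂ := (r : ℂ) * z

/-- The restriction of `F` to the compact set `K` is a continuous function on `K`
which belongs to the set `V ⊆ C(K)`. -/
def RestrictionMem {K : Compacts ℂ} (F : ℂ → ℂ) (V : Set C(K, ℂ)) : Prop :=
  ∃ h ∈ V, ∀ ζ : K, h ζ = F ζ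

/-- A non-empty open ball of `C(K)` for the uniform norm. -/
def IsOpenBall {K : Compacts ℂ} (V : Set C(K, ℂ)) : Prop :=
  ∃ (c : C(K, ℂ)) (δ : ℝ), 0 < δ ∧ V = Metric.ball c δ

/-- A compact interval contained in `[0,1)`; it may be a single point, or empty. -/
def IsSegment (S : Set ℝ) : Prop :=
  (∃ a b : ℝ, S = Icc a b) ∧ S ⊆ Ico 0 1

/-- A family of subsets of `[0,1)` is locally finite if every compact subset of `[0,1)` meets
at most finitely many of its members. -/
def LocallyFiniteFamily {ι : Type*} (S : ι → Set ℝ) : Prop :=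
  ∀ C : Set ℝ, IsCompact C → C ⊆ Ico 0 1 → {i | (S i ∩ C).Nonempty}.Finite

/-! A polynomial `p` close to the centre of `V_n(l)` on `K_l` is almost unchanged by dilations of
radius near 1. So it is enough that `f` be close to `p` on the sectors `r ζ`, with `ζ ∈ K_l` and `r`
in the part of `Γ(l,n)` beyond some `r(l,n)`. These sectors occupy disjoint ranges of radii that
accumulate only at the circle, and `exists_holomorphic_near` handles them all at once: working
outwards, it adds to `g` a correction that repairs one sector and is tiny on a disc containing `D`
and all earlier sectors. A correction is the current error times a polynomial near 0 on that disc
and near 1 on the sector (`exists_polynomial_separating`). Such polynomials exist because each `K_l`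
misses a point of the circle, so a ray escapes to infinity. Spectral theory in the closed algebra
generated by `z` turns this into polynomial approximation. -/

open Polynomial in
/-- The coordinate function, as an element of the uniform closure of the polynomials. -/
noncomputable def coordinateFunction (X : Set ℂ) [CompactSpace X] :
    (polynomialFunctions X).topologicalClosure :=
  ⟨toContinuousMapOnAlgHom X Polynomial.X, Subalgebra.le_topologicalClosure _
    ⟨Polynomial.X, trivial, rfl⟩⟩

@[simp]
lemma coordinateFunction_apply (X : Set ℂ) [CompactSpace X] (z : X) :
    (coordinateFunction X : C(X, ℂ)) z = z := by
  simp [coordinateFunction]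

/-! ### Spectra in the uniform closure of the polynomials -/

lemma exists_polynomial_near_of_mem_closure {X : Set ℂ} [CompactSpace X] {h : C(X, ℂ)}
    (hh : h ∈ (polynomialFunctions X).topologicalClosure) {η : ℝ} (hη : 0 < η) :
    ∃ p : Polynomial ℂ, ∀ z : X, ‖p.eval (z : ℂ) - h z‖ < η := by
  obtain ⟨-, ⟨p, -, rfl⟩, hp⟩ := Metric.mem_closure_iff.1 hh η hη
  refine ⟨p, fun z => ?_⟩
  have := (ContinuousMap.dist_lt_iff hη).1 hp z
  rw [dist_comm, dist_eq_norm] at this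
  simpa using this

/-- A point which can be joined to infinity outside `X` is not in the spectrum of the coordinate
function relative to the algebra of uniform limits of polynomials. -/
lemma notMem_spectrum_coordinateFunction {X S : Set ℂ} [CompactSpace X] {w : ℂ}
    (hS : IsPreconnected S) (hSX : S ⊆ Xᶜ) (hw : w ∈ S) (hunb : ¬ Bornology.IsBounded S) :
    w ∉ spectrum ℂ (coordinateFunction X) := by
  intro h
  have hcl : IsClosed ((polynomialFunctions X).topologicalClosure : Set C(X, ℂ)) :=
    Subalgebra.isClosed_topologicalClosure _
  -- Passing to a closed subalgebra can only add to the spectrum points from bounded components of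
  -- its complement.
  have hb := Subalgebra.spectrum_isBounded_connectedComponentIn _ _ h
  have hspec : spectrum ℂ (coordinateFunction X : C(X, ℂ)) = X := by
    rw [ContinuousMap.spectrum_eq_range]
    ext z
    simp
  rw [hspec] at hb
  exact hunb (hb.subset (hS.subset_connectedComponentIn hw hSX))

lemma not_isBounded_ray {ζ : ℂ} (hζ : ζ ∈ unitCircle) (t : ℝ) :
    ¬ Bornology.IsBounded ((fun x : ℝ => (x : ℂ) * ζ) '' Ici t) := by
  intro h
  obtain ⟨C, hC⟩ := h.exists_norm_le
  have := hC _ ⟨max t (|C| + 1), mem_Ici.2 (le_max_left _ _), rfl⟩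
  simp only [mem_sphere_iff_norm, sub_zero] at hζ
  rw [norm_mul, hζ, Complex.norm_real, mul_one, Real.norm_eq_abs] at this
  have h1 := le_abs_self (max t (|C| + 1))
  have h2 := le_max_right t (|C| + 1)
  have h3 := le_abs_self C
  linarith

lemma isPreconnected_ray (ζ : ℂ) (t : ℝ) :
    IsPreconnected ((fun x : ℝ => (x : ℂ) * ζ) '' Ici t) :=
  isPreconnected_Ici.image _ (by fun_prop)

/-! ### Separating a disc from an annular sector -/

/-- The set of all `r ζ` with `r ∈ [a, b]` and `ζ ∈ K`. -/
def annularSector (a b : ℝ) (K : Set ℂ) : Set ℂ :=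
  (fun q : ℝ × ℂ => (q.1 : ℂ) * q.2) '' (Icc a b ×ˢ K)

lemma isCompact_annularSector (a b : ℝ) {K : Set ℂ} (hK : IsCompact K) :
    IsCompact (annularSector a b K) :=
  (isCompact_Icc.prod hK).image (by fun_prop)

lemma mem_annularSector_norm {a b : ℝ} {K : Set ℂ} (hK : K ⊆ unitCircle) (ha : 0 ≤ a) {z : ℂ}
    (hz : z ∈ annularSector a b K) : a ≤ ‖z‖ ∧ ‖z‖ ≤ b := by
  obtain ⟨⟨r, ζ⟩, ⟨⟨hr1, hr2⟩, hζ⟩, rfl⟩ := hz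
  have := hK hζ
  simp only [mem_sphere_iff_norm, sub_zero] at this
  simp [this, abs_of_nonneg (ha.trans hr1), hr1, hr2]

lemma norm_lt_half_of_mul_sub_eq {e u w : ℂ} {η : ℝ} (h : ‖e‖ * ‖u - w‖ = ‖w‖)
    (hw : ‖w‖ < min (1 / 2) (η / 4) * ‖u‖) : ‖e‖ < η / 2 := by
  have hu : 0 < ‖u‖ := by
    rcases (norm_nonneg u).eq_or_lt with h0 | h0
    · rw [← h0, mul_zero] at hw
      exact absurd hw (norm_nonneg w).not_gt
    · exact h0
  have h1 : ‖w‖ < 1 / 2 * ‖u‖ :=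
    hw.trans_le (mul_le_mul_of_nonneg_right (min_le_left _ _) hu.le)
  have h2 : ‖w‖ < η / 4 * ‖u‖ :=
    hw.trans_le (mul_le_mul_of_nonneg_right (min_le_right _ _) hu.le)
  have h3 := norm_sub_norm_le u w
  have h4 : ‖e‖ * (‖u‖ / 2) ≤ ‖e‖ * ‖u - w‖ :=
    mul_le_mul_of_nonneg_left (by linarith) (norm_nonneg e)
  by_contra! h5
  have h6 : η / 2 * (‖u‖ / 2) ≤ ‖e‖ * (‖u‖ / 2) := mul_le_mul_of_nonneg_right h5 (by positivity)
  linarith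

/-- With `s < t < a` and `N` large, `z ^ N / (z ^ N - t ^ N)` is near 0 for `‖z‖ ≤ s` and near 1 for
`‖z‖ ≥ a`. Its poles have modulus `t` and can be joined to infinity off both sets, so it is a
uniform limit of polynomials there. -/
lemma exists_polynomial_separating {K : Set ℂ} (hK : IsCompact K) (hKc : K ⊆ unitCircle)
    (hne : K ≠ unitCircle) {s a : ℝ} (b : ℝ) (hs : 0 ≤ s) (hsa : s < a) {η : ℝ} (hη : 0 < η) :
    ∃ p : Polynomial ℂ, (∀ z, ‖z‖ ≤ s → ‖p.eval z‖ < η) ∧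
      ∀ z ∈ annularSector a b K, ‖p.eval z - 1‖ < η := by
  obtain ⟨t, hst, hta⟩ := exists_between hsa
  have ht : 0 < t := hs.trans_lt hst
  have ha : 0 < a := ht.trans hta
  obtain ⟨ζ, hζ, hζK⟩ := exists_of_ssubset (hKc.ssubset_of_ne hne)
  have hζ' : ‖ζ‖ = 1 := by simpa using hζ
  set X : Set ℂ := Metric.closedBall 0 s ∪ annularSector a b K with hX
  have : CompactSpace X := isCompact_iff_compactSpace.1
    ((isCompact_closedBall _ _).union (isCompact_annularSector a b hK))
  -- The circle of radius `t` holds the poles for every `N`; the ray leaves through the gap of `K`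
  -- at `ζ`.
  set S : Set ℂ := Metric.sphere 0 t ∪ (fun x : ℝ => (x : ℂ) * ζ) '' Ici t with hSdef
  have hS : IsPreconnected S := by
    refine IsPreconnected.union ((t : ℂ) * ζ) ?_ ⟨t, self_mem_Ici, rfl⟩
      (isPreconnected_sphere (by simp [Complex.rank_real_complex]) _ _) (isPreconnected_ray ζ t)
    simp [hζ', abs_of_pos ht]
  have hSX : S ⊆ Xᶜ := by
    rintro z hz (hzX | hzX)
    · have h1 : ‖z‖ ≤ s := by simpa using hzX
      rcases hz with hz | ⟨x, hx, rfl⟩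
      · have : ‖z‖ = t := by simpa using hz
        linarith
      · have hx' : t ≤ x := hx
        simp only [norm_mul, hζ', Complex.norm_real, Real.norm_eq_abs,
          abs_of_pos (ht.trans_le hx'), mul_one] at h1
        linarith
    · have h1 := mem_annularSector_norm hKc ha.le hzX
      rcases hz with hz | ⟨x, hx, rfl⟩
      · have : ‖z‖ = t := by simpa using hz
        linarith
      · have hx' : t ≤ x := hx
        obtain ⟨⟨r, ξ⟩, ⟨⟨hr1, hr2⟩, hξ⟩, h⟩ := hzX
        have hr1' : a ≤ r := hr1
        have hξ' : ‖ξ‖ = 1 := by simpa using hKc hξ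
        have h2 := congrArg norm h
        simp only [norm_mul, hζ', hξ', Complex.norm_real, Real.norm_eq_abs,
          abs_of_pos (ht.trans_le hx'), abs_of_pos (ha.trans_le hr1'), mul_one] at h2
        have hx0 : (x : ℂ) ≠ 0 := by exact_mod_cast (ht.trans_le hx').ne'
        subst h2
        exact hζK (mul_left_cancel₀ hx0 h ▸ hξ)
  have hunb : ¬ Bornology.IsBounded S := fun h =>
    not_isBounded_ray hζ t (h.subset subset_union_right)
  set x := coordinateFunction X with hx
  -- choose the exponent
  obtain ⟨N, hN0, hN1, hN2⟩ : ∃ N : ℕ, 0 < N ∧ (s / t) ^ N < min (1 / 2) (η / 4) ∧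
      (t / a) ^ N < min (1 / 2) (η / 4) := by
    have hpos : 0 < min (1 / 2) (η / 4) := by positivity
    have e1 := (tendsto_pow_atTop_nhds_zero_of_lt_one (div_nonneg hs ht.le)
      ((div_lt_one ht).2 hst)).eventually (gt_mem_nhds hpos)
    have e2 := (tendsto_pow_atTop_nhds_zero_of_lt_one (div_nonneg ht.le ha.le)
      ((div_lt_one ha).2 hta)).eventually (gt_mem_nhds hpos)
    obtain ⟨N, h1, h2, h3⟩ := ((Filter.eventually_gt_atTop 0).and (e1.and e2)).exists
    exact ⟨N, h1, h2, h3⟩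
  have hspec : (t : ℂ) ^ N ∉ spectrum ℂ (x ^ N) := by
    rw [spectrum.map_pow_of_pos x hN0]
    rintro ⟨w, hw, hwt⟩
    refine notMem_spectrum_coordinateFunction hS hSX (w := w) (Or.inl ?_) hunb hw
    have := congrArg norm hwt
    simp only [norm_pow, Complex.norm_real, Real.norm_eq_abs, abs_of_pos ht] at this
    simpa using (pow_left_inj₀ (norm_nonneg w) ht.le hN0.ne').1 this
  obtain ⟨u, hu⟩ := not_not.1 hspec
  set v := ((u⁻¹ : (polynomialFunctions X).topologicalClosureˣ) :
    (polynomialFunctions X).topologicalClosure) with hv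
  have huv : ∀ z : X, ((t : ℂ) ^ N - (z : ℂ) ^ N) * (v : C(X, ℂ)) z = 1 := by
    intro z
    have h1 : (algebraMap ℂ _ ((t : ℂ) ^ N) - x ^ N) * v = 1 := by rw [← hu]; exact u.mul_inv
    have h2 := congrArg (fun h : (polynomialFunctions X).topologicalClosure => (h : C(X, ℂ)) z) h1
    simpa [hx] using h2
  -- Since `v = 1 / (t ^ N - z ^ N)`, this function is `z ^ N / (z ^ N - t ^ N)`.
  have hmem : (1 - algebraMap ℂ _ ((t : ℂ) ^ N) * (v : C(X, ℂ))) ∈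
      (polynomialFunctions X).topologicalClosure :=
    sub_mem (one_mem _) (mul_mem (Subalgebra.algebraMap_mem _ _) v.2)
  obtain ⟨p, hp⟩ := exists_polynomial_near_of_mem_closure hmem (half_pos hη)
  have htN : (t : ℂ) ^ N ≠ 0 := pow_ne_zero _ (by exact_mod_cast ht.ne')
  refine ⟨p, fun z hz => ?_, fun z hz => ?_⟩
  · have hzX : z ∈ X := Or.inl (by simpa using hz)
    have h1 := hp ⟨z, hzX⟩
    have h2 := huv ⟨z, hzX⟩
    have hlt : ‖z ^ N‖ < min (1 / 2) (η / 4) * ‖(t : ℂ) ^ N‖ := by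
      rw [norm_pow, norm_pow, Complex.norm_real, Real.norm_eq_abs, abs_of_pos ht]
      rw [div_pow, div_lt_iff₀ (by positivity)] at hN1
      exact (pow_le_pow_left₀ (norm_nonneg z) hz N).trans_lt hN1
    have h3 : ‖1 - (t : ℂ) ^ N * (v : C(X, ℂ)) ⟨z, hzX⟩‖ < η / 2 := by
      refine norm_lt_half_of_mul_sub_eq ?_ hlt
      rw [← norm_mul, ← norm_neg]
      congr 1
      linear_combination (t : ℂ) ^ N * h2
    have h4 := norm_add_le (p.eval z - (1 - (t : ℂ) ^ N * (v : C(X, ℂ)) ⟨z, hzX⟩))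
      (1 - (t : ℂ) ^ N * (v : C(X, ℂ)) ⟨z, hzX⟩)
    rw [sub_add_cancel] at h4
    have h5 : ‖p.eval z - (1 - (t : ℂ) ^ N * (v : C(X, ℂ)) ⟨z, hzX⟩)‖ < η / 2 := by simpa using h1
    linarith
  · have hzX : z ∈ X := Or.inr hz
    have h1 := hp ⟨z, hzX⟩
    have h2 := huv ⟨z, hzX⟩
    have hlt : ‖(t : ℂ) ^ N‖ < min (1 / 2) (η / 4) * ‖z ^ N‖ := by
      rw [norm_pow, norm_pow, Complex.norm_real, Real.norm_eq_abs, abs_of_pos ht]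
      rw [div_pow, div_lt_iff₀ (by positivity)] at hN2
      refine hN2.trans_le (mul_le_mul_of_nonneg_left ?_ (by positivity))
      exact pow_le_pow_left₀ ha.le (mem_annularSector_norm hKc ha.le hz).1 N
    have h3 : ‖(t : ℂ) ^ N * (v : C(X, ℂ)) ⟨z, hzX⟩‖ < η / 2 := by
      refine norm_lt_half_of_mul_sub_eq ?_ hlt
      rw [← norm_mul, ← norm_neg]
      congr 1
      linear_combination (t : ℂ) ^ N * h2
    have h4 := norm_sub_le (p.eval z - (1 - (t : ℂ) ^ N * (v : C(X, ℂ)) ⟨z, hzX⟩))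
      ((t : ℂ) ^ N * (v : C(X, ℂ)) ⟨z, hzX⟩)
    have h5 : ‖p.eval z - (1 - (t : ℂ) ^ N * (v : C(X, ℂ)) ⟨z, hzX⟩)‖ < η / 2 := by simpa using h1
    have h6 : p.eval z - (1 - (t : ℂ) ^ N * (v : C(X, ℂ)) ⟨z, hzX⟩) -
        (t : ℂ) ^ N * (v : C(X, ℂ)) ⟨z, hzX⟩ = p.eval z - 1 := by ring
    rw [h6] at h4
    linarith

/-! ### Polynomial density on proper compact subsets of the circle -/

lemma ne_unitCircle_of_isConnected_compl {K : Set ℂ} (h : IsConnected Kᶜ) : K ≠ unitCircle := by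
  rintro rfl
  have h1 := h.isPreconnected.image norm continuous_norm.continuousOn
  have h0 : (0 : ℝ) ∈ norm '' (unitCircleᶜ : Set ℂ) := ⟨0, by simp, by simp⟩
  have h2 : (2 : ℝ) ∈ norm '' (unitCircleᶜ : Set ℂ) := ⟨2, by simp, by simp⟩
  obtain ⟨z, hz, hz1⟩ := h1.ordConnected.out h0 h2 (show (1 : ℝ) ∈ Icc 0 2 by norm_num)
  exact hz (by simpa using hz1)

/-- Polynomials are dense in the continuous functions on a proper compact subset of the circle. -/
lemma exists_polynomial_near {K : Compacts ℂ} (hKc : (K : Set ℂ) ⊆ unitCircle)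
    (hne : (K : Set ℂ) ≠ unitCircle) (c : C(K, ℂ)) {η : ℝ} (hη : 0 < η) :
    ∃ p : Polynomial ℂ, ∀ z : K, ‖p.eval (z : ℂ) - c z‖ < η := by
  have hcomp : CompactSpace (K : Set ℂ) := isCompact_iff_compactSpace.1 K.isCompact
  obtain ⟨ζ, hζ, hζK⟩ := exists_of_ssubset (hKc.ssubset_of_ne hne)
  have hζ' : ‖ζ‖ = 1 := by simpa using hζ
  set x := coordinateFunction (K : Set ℂ) with hx
  have hnorm : ∀ z : (K : Set ℂ), ‖(z : ℂ)‖ = 1 := fun z => by simpa using hKc z.2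
  have h0 : (0 : ℂ) ∉ spectrum ℂ x := by
    refine notMem_spectrum_coordinateFunction (isPreconnected_ray ζ 0) ?_
      ⟨0, self_mem_Ici, by simp⟩ (not_isBounded_ray hζ 0)
    rintro - ⟨r, hr, rfl⟩ hK
    have h1 := hnorm ⟨_, hK⟩
    have hr' : (0 : ℝ) ≤ r := hr
    simp only [norm_mul, hζ', Complex.norm_real, Real.norm_eq_abs, abs_of_nonneg hr', mul_one] at h1
    subst h1
    exact hζK (by simpa using hK)
  rw [spectrum.zero_notMem_iff] at h0
  obtain ⟨u, hu⟩ := h0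
  set v := ((u⁻¹ : (polynomialFunctions (K : Set ℂ)).topologicalClosureˣ) :
    (polynomialFunctions (K : Set ℂ)).topologicalClosure) with hv
  -- On the circle the inverse of `z` is its conjugate, so the closure is self-adjoint and
  -- Stone–Weierstrass applies.
  have hstar : (v : C((K : Set ℂ), ℂ)) =
      star (Polynomial.toContinuousMapOnAlgHom (K : Set ℂ) Polynomial.X) := by
    ext z
    have h1 : x * v = 1 := by rw [← hu]; exact u.mul_inv
    have h2 := congrArg (fun h : (polynomialFunctions (K : Set ℂ)).topologicalClosure =>
      (h : C((K : Set ℂ), ℂ)) z) h1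
    have h3 : (z : ℂ) * (v : C((K : Set ℂ), ℂ)) z = 1 := by
      rw [← coordinateFunction_apply]; exact h2
    have h4 : (z : ℂ) * star (z : ℂ) = 1 := by
      rw [Complex.star_def, Complex.mul_conj, Complex.normSq_eq_norm_sq, hnorm]; simp
    have h5 : (z : ℂ) ≠ 0 := left_ne_zero_of_mul_eq_one h4
    have h6 := coordinateFunction_apply (K : Set ℂ) z
    rw [ContinuousMap.star_apply, mul_left_cancel₀ h5 (h3.trans h4.symm), ← h6]
    rfl
  have htop : (polynomialFunctions (K : Set ℂ)).topologicalClosure = ⊤ := by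
    rw [eq_top_iff]
    have h1 := polynomialFunctions.starClosure_topologicalClosure (𝕜 := ℂ) (K : Set ℂ)
    have h2 : (polynomialFunctions (K : Set ℂ)).starClosure.toSubalgebra ≤
        (polynomialFunctions (K : Set ℂ)).topologicalClosure := by
      rw [polynomialFunctions.starClosure_eq_adjoin_X, StarAlgebra.adjoin_toSubalgebra]
      refine Algebra.adjoin_le ?_
      rintro h (rfl | hh)
      · exact x.2
      · have : h = v := by
          rw [hstar]
          rw [mem_star, mem_singleton_iff] at hh
          rw [← hh, star_star]
        rw [this]
        exact v.2
    intro h _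
    have h3 : h ∈ (polynomialFunctions (K : Set ℂ)).starClosure.topologicalClosure := by
      rw [h1]; trivial
    exact closure_minimal h2 (Subalgebra.isClosed_topologicalClosure _) h3
  exact exists_polynomial_near_of_mem_closure (X := (K : Set ℂ)) (h := c) (by rw [htop]; trivial) hη

/-! ### Simultaneous approximation by a series of corrections -/

lemma exists_correction {K : Set ℂ} (hK : IsCompact K) (hKc : K ⊆ unitCircle)
    (hne : K ≠ unitCircle) {s a b : ℝ} (hs : 0 ≤ s) (hsa : s < a) (hab : a ≤ b) (hb : b < 1)
    {F P : ℂ → ℂ} (hF : DifferentiableOn ℂ F unitDisc) (hP : DifferentiableOn ℂ P unitDisc)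
    {η : ℝ} (hη : 0 < η) :
    ∃ h : ℂ → ℂ, DifferentiableOn ℂ h unitDisc ∧ (∀ z, ‖z‖ ≤ s → ‖h z‖ ≤ η) ∧
      ∀ z ∈ annularSector a b K, ‖F z + h z - P z‖ ≤ η := by
  obtain ⟨C, hC⟩ := (isCompact_closedBall (0 : ℂ) b).exists_bound_of_continuousOn
    ((hP.sub hF).continuousOn.mono (Metric.closedBall_subset_ball hb))
  have hC' : ∀ z : ℂ, ‖z‖ ≤ b → ‖P z - F z‖ ≤ |C| + 1 := fun z hz => by
    have h1 := hC z (by simpa using hz)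
    have h2 := le_abs_self C
    simp only [Pi.sub_apply] at h1
    linarith
  have hpos : 0 < |C| + 1 := by positivity
  obtain ⟨p, hp1, hp2⟩ := exists_polynomial_separating hK hKc hne b hs hsa (div_pos hη hpos)
  refine ⟨fun z => (P z - F z) * p.eval z, (hP.sub hF).mul p.differentiable.differentiableOn,
    fun z hz => ?_, fun z hz => ?_⟩
  · rw [norm_mul]
    calc _ ≤ (|C| + 1) * (η / (|C| + 1)) :=
          mul_le_mul (hC' z (by linarith)) (hp1 z hz).le (norm_nonneg _) hpos.le
      _ = η := mul_div_cancel₀ _ hpos.ne'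
  · have h1 : F z + (P z - F z) * p.eval z - P z = (P z - F z) * (p.eval z - 1) := by ring
    rw [h1, norm_mul]
    calc _ ≤ (|C| + 1) * (η / (|C| + 1)) :=
          mul_le_mul (hC' z (mem_annularSector_norm hKc (hs.trans hsa.le) hz).2) (hp2 z hz).le
            (norm_nonneg _) hpos.le
      _ = η := mul_div_cancel₀ _ hpos.ne'

/-- On a ball of radius `R < 1`, all but finitely many terms are bounded by `u i` and the others are
bounded by compactness, so the Weierstrass test applies. -/
lemma differentiableOn_unitDisc_tsum {ι : Type*} {h : ι → ℂ → ℂ} {s u : ι → ℝ}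
    (hh : ∀ i, DifferentiableOn ℂ (h i) unitDisc) (hu : Summable u)
    (hs : ∀ R < 1, {i | s i < R}.Finite) (hle : ∀ i z, ‖z‖ ≤ s i → ‖h i z‖ ≤ u i) :
    DifferentiableOn ℂ (fun z => ∑' i, h i z) unitDisc ∧
      ∀ z ∈ unitDisc, Summable fun i => h i z := by
  have key : ∀ z ∈ unitDisc, ∃ R, z ∈ Metric.ball (0 : ℂ) R ∧
      DifferentiableOn ℂ (fun z => ∑' i, h i z) (Metric.ball 0 R) ∧ Summable fun i => h i z := by
    intro z hz
    obtain ⟨R, hzR, hR⟩ := exists_between (show ‖z‖ < 1 by simpa using hz)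
    have hC : ∀ i, ∃ C, ∀ w ∈ Metric.ball (0 : ℂ) R, ‖h i w‖ ≤ C := by
      intro i
      obtain ⟨C, hC⟩ := (isCompact_closedBall (0 : ℂ) R).exists_bound_of_continuousOn
        ((hh i).continuousOn.mono (Metric.closedBall_subset_ball hR))
      exact ⟨C, fun w hw => hC w (Metric.ball_subset_closedBall hw)⟩
    choose C hC using hC
    have hsum : Summable fun i => if s i < R then C i else u i := by
      refine hu.congr_cofinite ?_
      filter_upwards [(hs R hR).compl_mem_cofinite] with i hi
      exact (if_neg hi).symm
    have hbound : ∀ i, ∀ w ∈ Metric.ball (0 : ℂ) R,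
        ‖h i w‖ ≤ if s i < R then C i else u i := by
      intro i w hw
      split_ifs with hi
      · exact hC i w hw
      · have : ‖w‖ < R := by simpa using hw
        exact hle i w (by linarith)
    have hzR' : z ∈ Metric.ball (0 : ℂ) R := by simpa using hzR
    exact ⟨R, hzR', Complex.differentiableOn_tsum_of_summable_norm hsum
      (fun i => (hh i).mono (Metric.ball_subset_ball hR.le)) Metric.isOpen_ball hbound,
      hsum.of_norm_bounded fun i => hbound i z hzR'⟩
  refine ⟨fun z hz => ?_, fun z hz => ?_⟩
  · obtain ⟨R, hzR, hd, -⟩ := key z hz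
    exact (hd.differentiableAt (Metric.isOpen_ball.mem_nhds hzR)).differentiableWithinAt
  · obtain ⟨R, -, -, hs⟩ := key z hz
    exact hs

/-- Functions prescribed on pairwise disjoint annular sectors accumulating only at the circle
can be simultaneously approximated by one holomorphic function on the disc. -/
theorem exists_holomorphic_near {ι : Type*} [Countable ι] {a b δ : ι → ℝ} {K : ι → Set ℂ}
    {P : ι → ℂ → ℂ} {ρ : ℝ} (hK : ∀ i, IsCompact (K i)) (hKc : ∀ i, K i ⊆ unitCircle)
    (hne : ∀ i, K i ≠ unitCircle) (hP : ∀ i, DifferentiableOn ℂ (P i) unitDisc)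
    (hδ : ∀ i, 0 < δ i) (hρ : 0 ≤ ρ) (hρa : ∀ i, ρ < a i) (hab : ∀ i, a i ≤ b i)
    (hb : ∀ i, b i < 1) (hdisj : Pairwise fun i j => Disjoint (Icc (a i) (b i)) (Icc (a j) (b j)))
    (hfin : ∀ R < 1, {i | a i ≤ R}.Finite) {g : ℂ → ℂ} (hg : DifferentiableOn ℂ g unitDisc)
    {ε : ℝ} (hε : 0 < ε) :
    ∃ f : ℂ → ℂ, DifferentiableOn ℂ f unitDisc ∧ (∀ z, ‖z‖ ≤ ρ → ‖f z - g z‖ ≤ ε) ∧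
      ∀ i, ∀ z ∈ annularSector (a i) (b i) (K i), ‖f z - P i z‖ ≤ δ i := by
  classical
  have hfin' : ∀ i, {j | a j < a i}.Finite := fun i =>
    (hfin (a i) ((hab i).trans_lt (hb i))).subset fun j (hj : a j < a i) => hj.le
  let pre : ι → Finset ι := fun i => (hfin' i).toFinset
  have mem_pre : ∀ {i j}, j ∈ pre i ↔ a j < a i := fun {i j} => by simp [pre]
  have hwf : WellFounded fun j i => a j < a i := by
    refine Subrelation.wf ?_ (measure fun i => (pre i).card).wf
    intro j i hji
    refine Finset.card_lt_card ((Finset.ssubset_iff_of_subset ?_).2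
      ⟨j, mem_pre.2 hji, fun h => lt_irrefl _ (mem_pre.1 h)⟩)
    exact fun k hk => mem_pre.2 ((mem_pre.1 hk).trans hji)
  have hlt : ∀ {i j}, a j < a i → b j < a i := by
    intro i j hji
    by_contra! h
    have hij : j ≠ i := by rintro rfl; exact lt_irrefl _ hji
    exact disjoint_left.1 (hdisj hij) ⟨hji.le, h⟩ ⟨le_rfl, hab i⟩
  have hinj : ∀ {i j}, a j = a i → j = i := by
    intro i j hji
    by_contra hij
    exact disjoint_left.1 (hdisj hij) ⟨le_rfl, hab j⟩ ⟨hji.ge, hji.trans_le (hab i)⟩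
  -- The bound `2 * a i - 1 ≤ s` says `1 - s ≤ 2 * (1 - a i)`: it leaves only finitely many `s i`
  -- below any `R < 1`, as convergence of the series requires.
  have hs : ∀ i, ∃ s, ρ ≤ s ∧ 2 * a i - 1 ≤ s ∧ s < a i ∧ ∀ j, a j < a i → b j ≤ s := by
    intro i
    let T : Finset ℝ := insert ρ (insert (2 * a i - 1) ((pre i).image b))
    have hT : T.Nonempty := ⟨ρ, by simp [T]⟩
    refine ⟨T.max' hT, T.le_max' _ (by simp [T]), T.le_max' _ (by simp [T]), ?_,
      fun j hj => T.le_max' _ ?_⟩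
    · rw [Finset.max'_lt_iff]
      intro y hy
      simp only [T, Finset.mem_insert, Finset.mem_image] at hy
      rcases hy with rfl | rfl | ⟨j, hj, rfl⟩
      · exact hρa i
      · linarith [hab i, hb i]
      · exact hlt (mem_pre.1 hj)
    · simp only [T, Finset.mem_insert, Finset.mem_image]
      exact Or.inr (Or.inr ⟨j, mem_pre.2 hj, rfl⟩)
  choose s hρs has hsa hbs using hs
  -- The correction at `i` must respect the tolerances of all earlier sectors, its own and `ε`.
  have hm : ∀ i, ∃ m, 0 < m ∧ m ≤ ε ∧ ∀ j, a j ≤ a i → m ≤ δ j := by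
    intro i
    let T : Finset ℝ := insert ε (insert (δ i) ((pre i).image δ))
    have hT : T.Nonempty := ⟨ε, by simp [T]⟩
    refine ⟨T.min' hT, ?_, T.min'_le _ (by simp [T]), fun j hj => T.min'_le _ ?_⟩
    · rw [Finset.lt_min'_iff]
      intro y hy
      simp only [T, Finset.mem_insert, Finset.mem_image] at hy
      rcases hy with rfl | rfl | ⟨j, hj, rfl⟩
      exacts [hε, hδ _, hδ _]
    · simp only [T, Finset.mem_insert, Finset.mem_image]
      rcases hj.lt_or_eq with hj | hj
      · exact Or.inr (Or.inr ⟨j, mem_pre.2 hj, rfl⟩)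
      · exact Or.inr (Or.inl (by rw [hinj hj]))
  choose m hm0 hmε hmδ using hm
  obtain ⟨w, hw0, hwsum, hw1⟩ : ∃ w : ι → ℝ, (∀ i, 0 < w i) ∧ Summable w ∧ ∑' i, w i ≤ 1 := by
    have := Encodable.ofCountable ι
    obtain ⟨w, hw0, c, hwc, hc⟩ := posSumOfEncodable one_pos ι
    exact ⟨w, hw0, hwc.summable, hwc.tsum_eq.trans_le hc⟩
  -- Holomorphy of `F` is placed under the existential so that `next` is total; the recursion can
  -- then be defined before its terms are known to be holomorphic.
  have step : ∀ i (F : ℂ → ℂ), ∃ h : ℂ → ℂ, DifferentiableOn ℂ F unitDisc →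
      DifferentiableOn ℂ h unitDisc ∧ (∀ z, ‖z‖ ≤ s i → ‖h z‖ ≤ m i * w i) ∧
      ∀ z ∈ annularSector (a i) (b i) (K i), ‖F z + h z - P i z‖ ≤ m i * w i := by
    intro i F
    by_cases hF : DifferentiableOn ℂ F unitDisc
    · obtain ⟨h, hh⟩ := exists_correction (hK i) (hKc i) (hne i) (hρ.trans (hρs i)) (hsa i)
        (hab i) (hb i) hF (hP i) (mul_pos (hm0 i) (hw0 i))
      exact ⟨h, fun _ => hh⟩
    · exact ⟨0, fun h => absurd h hF⟩
  choose next hnext using step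
  let h : ι → ℂ → ℂ := hwf.fix fun i ih =>
    next i (g + ∑ j ∈ (pre i).attach, ih j (mem_pre.1 j.2))
  have h_eq : ∀ i, h i = next i (g + ∑ j ∈ pre i, h j) := by
    intro i
    rw [← Finset.sum_attach]
    exact hwf.fix_eq _ i
  have hdiff : ∀ i, DifferentiableOn ℂ (h i) unitDisc := by
    intro i
    induction i using hwf.induction with
    | h i ih =>
      rw [h_eq]
      exact (hnext i _ (hg.add (DifferentiableOn.sum fun j hj => ih j (mem_pre.1 hj)))).1
  have hspec : ∀ i, (∀ z, ‖z‖ ≤ s i → ‖h i z‖ ≤ m i * w i) ∧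
      ∀ z ∈ annularSector (a i) (b i) (K i),
        ‖g z + ∑ j ∈ pre i, h j z + h i z - P i z‖ ≤ m i * w i := by
    intro i
    have := (hnext i _ (hg.add (DifferentiableOn.sum fun j (_ : j ∈ pre i) => hdiff j))).2
    rw [← h_eq] at this
    simpa using this
  have hεle : ∀ i z, ‖z‖ ≤ s i → ‖h i z‖ ≤ ε * w i := fun i z hz =>
    ((hspec i).1 z hz).trans (mul_le_mul_of_nonneg_right (hmε i) (hw0 i).le)
  obtain ⟨hd, hsum⟩ := differentiableOn_unitDisc_tsum hdiff (hwsum.mul_left ε)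
    (fun R hR => (hfin ((1 + R) / 2) (by linarith)).subset fun i (hi : s i < R) =>
      show a i ≤ (1 + R) / 2 by linarith [has i]) hεle
  refine ⟨fun z => g z + ∑' i, h i z, hg.add hd, fun z hz => ?_, fun i z hz => ?_⟩
  · rw [add_sub_cancel_left]
    refine (tsum_of_norm_bounded (hwsum.mul_left ε).hasSum
      fun i => hεle i z (hz.trans (hρs i))).trans ?_
    rw [tsum_mul_left]
    exact mul_le_of_le_one_right hε.le hw1
  · have hzn := mem_annularSector_norm (hKc i) (hρ.trans (hρa i).le) hz
    have hz1 : z ∈ unitDisc := by simpa using hzn.2.trans_lt (hb i)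
    -- The partial sum through `i` errs by at most `δ i * w i`, and the later corrections by `δ i`
    -- times the remaining weights; the weights sum to at most 1.
    let B : Finset ι := insert i (pre i)
    have hi : i ∉ pre i := fun h => lt_irrefl _ (mem_pre.1 h)
    beta_reduce
    rw [← (hsum z hz1).sum_add_tsum_subtype_compl B, Finset.sum_insert hi]
    have hwB := hwsum.sum_add_tsum_subtype_compl B
    rw [Finset.sum_insert hi] at hwB
    have hpre : 0 ≤ ∑ j ∈ pre i, w j := Finset.sum_nonneg fun j _ => (hw0 j).le
    have htail : ‖∑' j : {j // j ∉ B}, h j z‖ ≤ δ i * ∑' j : {j // j ∉ B}, w j := by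
      rw [← tsum_mul_left]
      refine tsum_of_norm_bounded ((hwsum.subtype _).mul_left (δ i)).hasSum fun j => ?_
      have hj : a i < a j := by
        have h1 : (j : ι) ≠ i ∧ ¬ a j < a i := by
          have := j.2
          simpa only [B, Finset.mem_insert, mem_pre, not_or] using this
        exact lt_of_le_of_ne (not_lt.1 h1.2) fun h => h1.1 (hinj h.symm)
      exact ((hspec j).1 z (hzn.2.trans (hbs j i hj))).trans
        (mul_le_mul_of_nonneg_right (hmδ j i hj.le) (hw0 j).le)
    have hhead := ((hspec i).2 z hz).trans
      (mul_le_mul_of_nonneg_right (hmδ i i le_rfl) (hw0 i).le)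
    have hsplit := norm_add_le (g z + ∑ j ∈ pre i, h j z + h i z - P i z)
      (∑' j : {j // j ∉ B}, h j z)
    have heq : g z + (h i z + ∑ j ∈ pre i, h j z + ∑' j : {j // j ∉ B}, h j z) - P i z =
        g z + ∑ j ∈ pre i, h j z + h i z - P i z + ∑' j : {j // j ∉ B}, h j z := by ring
    rw [heq]
    have hle : δ i * w i + δ i * ∑' j : {j // j ∉ B}, w j ≤ δ i := by
      rw [← mul_add]
      exact mul_le_of_le_one_right (hδ i).le (by linarith)
    linarith

/-! ### Dilations and the conclusion -/

lemma exists_radius_dilation_near {p : ℂ → ℂ} (hp : Continuous p) {η ρ : ℝ} (hη : 0 < η)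
    (hρ : ρ < 1) :
    ∃ r₀, ρ < r₀ ∧ r₀ < 1 ∧ ∀ r ∈ Ico r₀ 1, ∀ ζ ∈ unitCircle, ‖p (r * ζ) - p ζ‖ < η := by
  obtain ⟨d, hd, h⟩ := Metric.uniformContinuousOn_iff.1
    ((isCompact_closedBall (0 : ℂ) 1).uniformContinuousOn_of_continuous hp.continuousOn) η hη
  obtain ⟨r₀, h1, h2⟩ := exists_between (max_lt (max_lt hρ one_pos) (sub_lt_self 1 hd))
  simp only [max_lt_iff] at h1
  refine ⟨r₀, h1.1.1, h2, fun r hr ζ hζ => ?_⟩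
  have hζ' : ‖ζ‖ = 1 := by simpa using hζ
  have hr0 : 0 ≤ r := h1.1.2.le.trans hr.1
  rw [← dist_eq_norm]
  refine h _ ?_ _ (by simp [hζ']) ?_
  · simpa [hζ', abs_of_nonneg hr0] using hr.2.le
  · have h3 : (r : ℂ) * ζ - ζ = ((r - 1 : ℝ) : ℂ) * ζ := by push_cast; ring
    rw [dist_eq_norm, h3, norm_mul, hζ', mul_one, Complex.norm_real, Real.norm_eq_abs, abs_lt]
    constructor <;> linarith [hr.1, hr.2]

lemma restrictionMem_ball {K : Compacts ℂ} (hKc : (K : Set ℂ) ⊆ unitCircle) {f : ℂ → ℂ}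
    (hf : HolomorphicOnDisc f) {r : ℝ} (hr : r ∈ Ico (0 : ℝ) 1) {c : C(K, ℂ)} {δ : ℝ} (hδ : 0 < δ)
    (h : ∀ ζ : K, ‖f (r * ζ) - c ζ‖ < δ) :
    RestrictionMem (f ∘ dilation r) (Metric.ball c δ) := by
  have hmaps : ∀ ζ : K, (r : ℂ) * ζ ∈ unitDisc := fun ζ => by
    have : ‖(ζ : ℂ)‖ = 1 := by simpa using hKc ζ.2
    simpa [this, abs_of_nonneg hr.1] using hr.2
  refine ⟨⟨fun ζ => f (r * ζ), hf.continuousOn.comp_continuous (by fun_prop) hmaps⟩, ?_,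
    fun ζ => rfl⟩
  rw [Metric.mem_ball, ContinuousMap.dist_lt_iff hδ]
  intro ζ
  rw [dist_eq_norm]
  exact h ζ

theorem proposition6p1
    -- the compact sets `K_l`, exhausting the proper compact subsets of the circle
    (K : ℕ → Compacts ℂ)
    (hKcircle : ∀ l, (K l : Set ℂ) ⊆ unitCircle)
    (hKcompl : ∀ l, IsConnected ((K l : Set ℂ)ᶜ))
    (hKexhaust : ∀ L : Set ℂ, IsCompact L → L ⊆ unitCircle → L ≠ unitCircle →
      ∃ l, L ⊆ (K l : Set ℂ))
    -- the balls `V_n(l)`, a base of the topology of `C(K_l)` for every `l`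
    (V : (l : ℕ) → ℕ → Set C(K l, ℂ))
    (hVball : ∀ l n, IsOpenBall (V l n))
    (hVbasis : ∀ l, IsTopologicalBasis (range (V l)))
    -- the segments `Γ(l,n,m)`
    (Γ : ℕ × ℕ × ℕ → Set ℝ)
    (hΓseg : ∀ i, IsSegment (Γ i))
    (hΓdisj : Pairwise (fun i j => Disjoint (Γ i) (Γ j)))
    (hΓfin : LocallyFiniteFamily Γ)
    (ε : ℝ) (hε : 0 < ε)
    (g : ℂ → ℂ) (hg : HolomorphicOnDisc g)
    -- the radius of the closed disc `D`
    (ρ : ℝ) (hρ : ρ < 1) :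
    ∃ (r₀ : ℕ → ℕ → ℝ) (f : ℂ → ℂ),
      (∀ l n, r₀ l n ∈ Ico (0 : ℝ) 1) ∧
      HolomorphicOnDisc f ∧
      -- the supremum of `|f - g|` over `D` is smaller than `ε`
      (∃ δ < ε, ∀ z ∈ Metric.closedBall (0 : ℂ) ρ, ‖f z - g z‖ ≤ δ) ∧
      ∀ l n, ∀ r ∈ (⋃ m, Γ (l, n, m)) ∩ Ico (r₀ l n) 1,
        RestrictionMem (f ∘ dilation r) (V l n) := by
  have hne : ∀ l, (K l : Set ℂ) ≠ unitCircle := fun l =>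
    ne_unitCircle_of_isConnected_compl (hKcompl l)
  choose c δ hδ hV using hVball
  have hp := fun l n => exists_polynomial_near (hKcircle l) (hne l) (c l n)
    (div_pos (hδ l n) three_pos)
  choose p hp using hp
  -- `ρ` may be negative, whereas the construction needs a nonnegative radius.
  have hρ' : max ρ 0 < 1 := max_lt hρ one_pos
  have hr := fun l n => exists_radius_dilation_near (p l n).continuous
    (div_pos (hδ l n) three_pos) hρ'
  choose r₀ hρr hr1 hr using hr
  have hr0 : ∀ l n, 0 ≤ r₀ l n := fun l n => (le_max_right ρ 0).trans (hρr l n).le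
  choose hΓIcc hΓsub using hΓseg
  choose A B hAB using hΓIcc
  -- Only segments that still have a point after truncation at `r₀` are kept.
  let ι := {i : ℕ × ℕ × ℕ // max (A i) (r₀ i.1 i.2.1) ≤ B i}
  have hmemΓ : ∀ (i : ι) (x : ℝ), max (A i) (r₀ i.1.1 i.1.2.1) ≤ x → x ≤ B i → x ∈ Γ i :=
    fun i x h1 h2 => by
      rw [hAB]
      exact ⟨(le_max_left _ _).trans h1, h2⟩
  obtain ⟨f, hf, hfg, hfP⟩ := exists_holomorphic_near (ι := ι)
    (a := fun i => max (A i) (r₀ i.1.1 i.1.2.1)) (b := fun i => B i)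
    (δ := fun i => δ i.1.1 i.1.2.1 / 3) (K := fun i => K i.1.1)
    (P := fun i z => (p i.1.1 i.1.2.1).eval z) (ρ := max ρ 0) (fun i => (K i.1.1).isCompact)
    (fun i => hKcircle _) (fun i => hne _) (fun i => (Polynomial.differentiable _).differentiableOn)
    (fun i => div_pos (hδ _ _) three_pos) (le_max_right _ _)
    (fun i => (hρr _ _).trans_le (le_max_right _ _)) (fun i => i.2)
    (fun i => (hΓsub _ (hmemΓ i _ i.2 le_rfl)).2)
    (fun i j hij => (hΓdisj (Subtype.coe_injective.ne hij)).mono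
      (fun x hx => hmemΓ i x hx.1 hx.2) (fun x hx => hmemΓ j x hx.1 hx.2))
    (fun R hR => by
      refine Finite.of_finite_image ((hΓfin (Icc 0 R) isCompact_Icc
        fun x hx => ⟨hx.1, hx.2.trans_lt hR⟩).subset ?_) (Subtype.coe_injective.injOn)
      rintro - ⟨i, hi, rfl⟩
      exact ⟨_, hmemΓ i _ le_rfl i.2, (hr0 _ _).trans (le_max_right _ _), hi⟩)
    hg (half_pos hε)
  refine ⟨r₀, f, fun l n => ⟨hr0 l n, hr1 l n⟩, hf, ⟨ε / 2, half_lt_self hε, fun z hz =>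
    hfg z ((mem_closedBall_zero_iff.1 hz).trans (le_max_left _ _))⟩, ?_⟩
  rintro l n r ⟨hrΓ, hrr⟩
  obtain ⟨m, hm⟩ := mem_iUnion.1 hrΓ
  have hm' := hm
  rw [hAB] at hm'
  rw [hV]
  refine restrictionMem_ball (hKcircle l) hf (hΓsub _ hm) (hδ l n) fun ζ => ?_
  -- Three errors of at most `δ / 3`: `f` against `p` on the sector, `p` against its dilate, and `p`
  -- against the centre `c`; the last two are strict.
  have h1 := hfP ⟨(l, n, m), (max_le hm'.1 hrr.1).trans hm'.2⟩ (r * ζ)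
    ⟨(r, ζ), ⟨⟨max_le hm'.1 hrr.1, hm'.2⟩, ζ.2⟩, rfl⟩
  have h2 := hr l n r hrr ζ (hKcircle l ζ.2)
  have h3 := hp l n ζ
  have h4 := norm_add_le (f (r * ζ) - (p l n).eval ((r : ℂ) * ζ))
    ((p l n).eval ((r : ℂ) * ζ) - (p l n).eval (ζ : ℂ) + ((p l n).eval (ζ : ℂ) - c l n ζ))
  have h5 := norm_add_le ((p l n).eval ((r : ℂ) * ζ) - (p l n).eval (ζ : ℂ))
    ((p l n).eval (ζ : ℂ) - c l n ζ)
  have h6 : f (r * ζ) - (p l n).eval ((r : ℂ) * ζ) + ((p l n).eval ((r : ℂ) * ζ) -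
      (p l n).eval (ζ : ℂ) + ((p l n).eval (ζ : ℂ) - c l n ζ)) = f (r * ζ) - c l n ζ := by ring
  rw [h6] at h4
  dsimp only at h1
  linarith
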